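/- Consider the de Sitter algebra with generators $J_i, K_i, V_i$ ($i=x,y,z$) and $V_t$ and the commutation relations $$[J_i,J_j]=i\epsilon_{ijk}J_k,\quad [K_i,K_j]=-i\epsilon_{ijk}J_k,\quad [J_i,K_j]=i\epsilon_{ijk}K_k,$$ $$[J_i,V_j]=i\epsilon_{ijk}V_k,\quad [K_i,V_j]=-iV_t\delta_{ij},\quad [J_i,V_t]=0,\quad [K_i,V_t]=-iV_i,$$ $$[V_i,V_j]=i\epsilon_{ijk}J_k,\quad [V_t,V_i]=iK_i .$$ A representation is a choice of ten complex square matrices of the same finite size that satisfy these relations. For $A,B\in\{0,\tfrac12,1,\dots\}$ let $(A,B)$ denote the irreducible representation of the homogeneous Lorentz algebra $\{J_i,K_i\}$ given by $J_i=A_i\otimes 1+1\otimes B_i$ and $K_i=i(1\otimes B_i-A_i\otimes 1)$, where $A_i$ and $B_i$ are the standard spin-$A$ and spin-$B$ matrices of $\mathfrak{su}(2)$. A backbone is a finite direct sum $(A_1,B_1)\oplus\dots\oplus(A_N,B_N)$, repetitions allowed, and a representation of the de Sitter algebra has this backbone if its restriction to $\{J_i,K_i\}$ is equivalent to this direct sum.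 **Theorem.** For any given backbone there is, up to unitary equivalence, at most one representation of the de Sitter algebra in which each of the ten generators is Hermitian or anti-Hermitian: if two such representations have the same backbone, then there is a single unitary matrix $U$ with $UXU^\dagger=X'$ for each of the ten generators, where $X$ and $X'$ denote the matrices of that generator in the two representations. -/

import Mathlib

open scoped Matrix Kronecker

noncomputable section

namespace DeSitter

/-! ### The irreducible representations of `su(2)`

The spin `A ∈ {0, 1/2, 1, …}` is encoded by the natural number `k = 2A`. The basis index
`i ∈ {0, …, k}` stands for the weight `a = i - A ∈ {-A, -A + 1, …, A}`. -/

/-- The spin `A = k / 2`. -/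
def spin (k : ℕ) : ℝ := (k : ℝ) / 2

/-- The weight `a = i - A` attached to the basis index `i`. -/
def weight (k : ℕ) (i : Fin (k + 1)) : ℝ := (i : ℝ) - spin k

/-- The raising matrix `A⁺`: entry `√((A - a₂)(A + a₂ + 1))` where `a₁ = a₂ + 1`. -/
def spinPlus (k : ℕ) : Matrix (Fin (k + 1)) (Fin (k + 1)) ℂ :=
  Matrix.of fun i j =>
    if (i : ℕ) = (j : ℕ) + 1 then
      ((Real.sqrt ((spin k - weight k j) * (spin k + weight k j + 1)) : ℝ) : ℂ)
    else 0

/-- The lowering matrix `A⁻`: entry `√((A + a₂)(A - a₂ + 1))` where `a₁ = a₂ - 1`. -/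
def spinMinus (k : ℕ) : Matrix (Fin (k + 1)) (Fin (k + 1)) ℂ :=
  Matrix.of fun i j =>
    if (i : ℕ) + 1 = (j : ℕ) then
      ((Real.sqrt ((spin k + weight k j) * (spin k - weight k j + 1)) : ℝ) : ℂ)
    else 0

/-- The diagonal matrix `A_z` of weights. -/
def spinZ (k : ℕ) : Matrix (Fin (k + 1)) (Fin (k + 1)) ℂ :=
  Matrix.diagonal fun i => ((weight k i : ℝ) : ℂ)

/-- The matrices `(A_x, A_y, A_z)`, where `A^± = A_x ± i A_y`. -/
def spinMat (k : ℕ) : Fin 3 → Matrix (Fin (k + 1)) (Fin (k + 1)) ℂ :=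
  ![(1 / 2 : ℂ) • (spinPlus k + spinMinus k),
    (1 / (2 * Complex.I) : ℂ) • (spinPlus k - spinMinus k),
    spinZ k]

/-! ### The irreducible representations `(A, B)` of the homogeneous Lorentz algebra -/

/-- `J_i = A_i ⊗ 1 + 1 ⊗ B_i` in the irrep `(A, B) = (k / 2, l / 2)`. -/
def blockJ (k l : ℕ) (i : Fin 3) :
    Matrix (Fin (k + 1) × Fin (l + 1)) (Fin (k + 1) × Fin (l + 1)) ℂ :=
  spinMat k i ⊗ₖ 1 + 1 ⊗ₖ spinMat l i

/-- `K_i = i (1 ⊗ B_i - A_i ⊗ 1)` in the irrep `(A, B) = (k / 2, l / 2)`. -/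
def blockK (k l : ℕ) (i : Fin 3) :
    Matrix (Fin (k + 1) × Fin (l + 1)) (Fin (k + 1) × Fin (l + 1)) ℂ :=
  Complex.I • (1 ⊗ₖ spinMat l i - spinMat k i ⊗ₖ 1)

/-! ### Backbones -/

/-- A Lorentz backbone `(A_1, B_1) ⊕ … ⊕ (A_N, B_N)`, duplicates allowed; the block `P` is
recorded by the pair of natural numbers `(2 A_P, 2 B_P)`. -/
abbrev Backbone (N : ℕ) : Type := Fin N → ℕ × ℕ

/-- The basis of the direct sum: a block number together with a pair of weight indices. -/
abbrev Backbone.Index {N : ℕ} (s : Backbone N) : Type :=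
  (P : Fin N) × (Fin ((s P).1 + 1) × Fin ((s P).2 + 1))

/-- The block-diagonal matrices `J_i` of the backbone. -/
def Backbone.J {N : ℕ} (s : Backbone N) (i : Fin 3) : Matrix s.Index s.Index ℂ :=
  Matrix.blockDiagonal' fun P => blockJ (s P).1 (s P).2 i

/-- The block-diagonal matrices `K_i` of the backbone. -/
def Backbone.K {N : ℕ} (s : Backbone N) (i : Fin 3) : Matrix s.Index s.Index ℂ :=
  Matrix.blockDiagonal' fun P => blockK (s P).1 (s P).2 i

/-! ### Representations of the de Sitter algebra -/

/-- The Levi-Civita symbol, with `0, 1, 2` standing for `x, y, z`. -/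
def eps (i j k : Fin 3) : ℂ :=
  if (i, j, k) = (0, 1, 2) ∨ (i, j, k) = (1, 2, 0) ∨ (i, j, k) = (2, 0, 1) then 1
  else if (i, j, k) = (0, 2, 1) ∨ (i, j, k) = (2, 1, 0) ∨ (i, j, k) = (1, 0, 2) then -1
  else 0

/-- Ten complex square matrices `J_i, K_i, V_i, V_t` (`i = x, y, z`). -/
structure Generators (n : Type*) where
  J : Fin 3 → Matrix n n ℂ
  K : Fin 3 → Matrix n n ℂ
  V : Fin 3 → Matrix n n ℂ
  Vt : Matrix n n ℂ

/-- The commutation relations of the de Sitter algebra. -/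
structure Generators.IsDSRep {n : Type*} [Fintype n] [DecidableEq n] (R : Generators n) :
    Prop where
  JJ : ∀ i j, ⁅R.J i, R.J j⁆ = Complex.I • ∑ k, eps i j k • R.J k
  KK : ∀ i j, ⁅R.K i, R.K j⁆ = -(Complex.I • ∑ k, eps i j k • R.J k)
  JK : ∀ i j, ⁅R.J i, R.K j⁆ = Complex.I • ∑ k, eps i j k • R.K k
  JV : ∀ i j, ⁅R.J i, R.V j⁆ = Complex.I • ∑ k, eps i j k • R.V k
  KV : ∀ i j, ⁅R.K i, R.V j⁆ = if i = j then -(Complex.I • R.Vt) else 0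
  JVt : ∀ i, ⁅R.J i, R.Vt⁆ = 0
  KVt : ∀ i, ⁅R.K i, R.Vt⁆ = -(Complex.I • R.V i)
  VV : ∀ i j, ⁅R.V i, R.V j⁆ = Complex.I • ∑ k, eps i j k • R.J k
  VtV : ∀ i, ⁅R.Vt, R.V i⁆ = Complex.I • R.K i

/-- A matrix that is Hermitian or anti-Hermitian. -/
def HOrAH {n : Type*} (X : Matrix n n ℂ) : Prop := Xᴴ = X ∨ Xᴴ = -X

/-- Each of the ten generators is Hermitian or anti-Hermitian. -/
structure Generators.IsHOrAH {n : Type*} (R : Generators n) : Prop where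
  J : ∀ i, HOrAH (R.J i)
  K : ∀ i, HOrAH (R.K i)
  V : ∀ i, HOrAH (R.V i)
  Vt : HOrAH R.Vt

/-- The restriction of `R` to the homogeneous Lorentz algebra is equivalent to the direct sum
`s`: an invertible matrix `S`, with inverse `T`, carries the one to the other. -/
def Generators.HasBackbone {n : Type*} [Fintype n] [DecidableEq n] (R : Generators n)
    {N : ℕ} (s : Backbone N) : Prop :=
  ∃ (S : Matrix n s.Index ℂ) (T : Matrix s.Index n ℂ), S * T = 1 ∧ T * S = 1 ∧
    (∀ i, R.J i = S * s.J i * T) ∧ (∀ i, R.K i = S * s.K i * T)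

/-- Unitary equivalence: one unitary matrix `U` carries all ten generators of `R` to those
of `R'`. -/
def Generators.UnitarilyEquivalent {n m : Type*} [Fintype n] [DecidableEq n] [Fintype m]
    [DecidableEq m] (R : Generators n) (R' : Generators m) : Prop :=
  ∃ U : Matrix m n ℂ, U * Uᴴ = 1 ∧ Uᴴ * U = 1 ∧
    (∀ i, U * R.J i * Uᴴ = R'.J i) ∧ (∀ i, U * R.K i * Uᴴ = R'.K i) ∧
    (∀ i, U * R.V i * Uᴴ = R'.V i) ∧ U * R.Vt * Uᴴ = R'.Vt

end DeSitter

end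

/-! ### Unitary highest weight theory -/

noncomputable section

namespace DeSitter

/-! The trace form is invariant, so tr J_i² = tr V_i² = -tr K_i² = -tr V_t² (`trace_sq`). This
removes the choice in "Hermitian or anti-Hermitian": J and V are Hermitian, K and V_t anti-Hermitian
(`conjTranspose_eq`). Both representations are therefore unitary for the compact form so(5). Its
rank is 2 and the Cartan elements J_z, K_z already lie in the Lorentz algebra, so the backbone fixes
every weight multiplicity (`finrank_weightSpace_le`).

It remains to see that unitary representations on E and E' with equal multiplicities are
isometrically isomorphic (`exists_isometryEquiv`). Take a maximal invariant D in E × E' on which the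
two inner products agree. If D does not project onto E, the orthogonal complements of its
projections share a highest weight; a pair of unit vectors of that weight generates a partial
isometry (`isPartialIsometry_cyclic`) orthogonal to D, so D was not maximal
(`map_fst_eq_top_of_maximal`). -/

/-- A complex vector space with a bracket, a conjugation, two Cartan elements `h₁, h₂` and a family
of simultaneous eigenvectors `e` (the positive root vectors) which, together with their conjugates
and the Cartan elements, span the space; `height` increases along the roots. -/
structure TriangularData (𝔤 : Type*) [AddCommGroup 𝔤] [Module ℂ 𝔤] where
  bracket : 𝔤 → 𝔤 → 𝔤
  conj : 𝔤 → 𝔤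
  h₁ : 𝔤
  h₂ : 𝔤
  Root : Type
  e : Root → 𝔤
  α : Root → ℂ
  β : Root → ℂ
  bracket_h₁ : ∀ r, bracket h₁ (e r) = α r • e r
  bracket_h₂ : ∀ r, bracket h₂ (e r) = β r • e r
  bracket_h₁_h₂ : bracket h₁ h₂ = 0
  height : ℂ → ℂ → ℝ
  height_lt : ∀ r a b, height a b < height (a + α r) (b + β r)
  mem_span : ∀ x, x ∈ Submodule.span ℂ ({h₁, h₂} ∪ Set.range e ∪ Set.range fun r => conj (e r))

section

variable {𝔤 : Type*} [AddCommGroup 𝔤] [Module ℂ 𝔤] (T : TriangularData 𝔤)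
  {E : Type*} [NormedAddCommGroup E] [InnerProductSpace ℂ E]
  {E' : Type*} [NormedAddCommGroup E'] [InnerProductSpace ℂ E']

/-- A linear action which respects the bracket, and the adjoints of which are given by the
conjugation. -/
structure TriangularData.IsUnitaryRep (ρ : 𝔤 →ₗ[ℂ] Module.End ℂ E) : Prop where
  map_bracket : ∀ x y u, ρ x (ρ y u) = ρ y (ρ x u) + ρ (T.bracket x y) u
  inner_map : ∀ x u v, inner ℂ (ρ x u) v = inner ℂ u (ρ (T.conj x) v)

/-- The simultaneous eigenspaces of the Cartan elements. -/
def TriangularData.weightSpace (ρ : 𝔤 →ₗ[ℂ] Module.End ℂ E) (a b : ℂ) : Submodule ℂ E :=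
  (ρ T.h₁).eigenspace a ⊓ (ρ T.h₂).eigenspace b

theorem TriangularData.mem_weightSpace {ρ : 𝔤 →ₗ[ℂ] Module.End ℂ E} {a b : ℂ} {u : E} :
    u ∈ T.weightSpace ρ a b ↔ ρ T.h₁ u = a • u ∧ ρ T.h₂ u = b • u := by
  simp [weightSpace]

/-- An invariant subspace of `E × E'` on which the two inner products agree, that is, the graph of
an isometric isomorphism between subrepresentations of `E` and `E'`. -/
structure IsPartialIsometry (ρ : 𝔤 →ₗ[ℂ] Module.End ℂ E) (ρ' : 𝔤 →ₗ[ℂ] Module.End ℂ E')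
    (D : Submodule ℂ (E × E')) : Prop where
  invariant : ∀ x, ∀ d ∈ D, (ρ x d.1, ρ' x d.2) ∈ D
  inner_eq : ∀ c ∈ D, ∀ d ∈ D, inner ℂ c.1 d.1 = inner ℂ c.2 d.2

variable {T} {ρ : 𝔤 →ₗ[ℂ] Module.End ℂ E} {ρ' : 𝔤 →ₗ[ℂ] Module.End ℂ E'}

theorem TriangularData.IsUnitaryRep.inner_map_conj (hρ : T.IsUnitaryRep ρ) (x : 𝔤) (u v : E) :
    inner ℂ (ρ (T.conj x) u) v = inner ℂ u (ρ x v) := by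
  rw [← inner_conj_symm, ← hρ.inner_map, inner_conj_symm]

theorem TriangularData.IsUnitaryRep.map_e_mem_weightSpace (hρ : T.IsUnitaryRep ρ) (r : T.Root)
    {a b : ℂ} {u : E} (hu : u ∈ T.weightSpace ρ a b) :
    ρ (T.e r) u ∈ T.weightSpace ρ (a + T.α r) (b + T.β r) := by
  rw [T.mem_weightSpace] at hu ⊢
  rw [hρ.map_bracket T.h₁, hρ.map_bracket T.h₂, hu.1, hu.2, T.bracket_h₁, T.bracket_h₂]
  simp [add_smul]

/-- Submodules that are invariant under a representation. -/
def IsInvariant (ρ : 𝔤 →ₗ[ℂ] Module.End ℂ E) (W : Submodule ℂ E) : Prop :=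
  ∀ x, ∀ u ∈ W, ρ x u ∈ W

theorem TriangularData.IsUnitaryRep.isInvariant_orthogonal (hρ : T.IsUnitaryRep ρ)
    {W : Submodule ℂ E} (hW : IsInvariant ρ W) : IsInvariant ρ Wᗮ := by
  intro x u hu
  rw [Submodule.mem_orthogonal] at hu ⊢
  intro w hw
  rw [← hρ.inner_map_conj]
  exact hu _ (hW _ _ hw)

theorem IsPartialIsometry.isInvariant_map_fst {D : Submodule ℂ (E × E')}
    (hD : IsPartialIsometry ρ ρ' D) : IsInvariant ρ (D.map (LinearMap.fst ℂ E E')) := by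
  rintro x _ ⟨d, hd, rfl⟩
  exact ⟨_, hD.invariant x d hd, rfl⟩

theorem IsPartialIsometry.swap {D : Submodule ℂ (E × E')} (hD : IsPartialIsometry ρ ρ' D) :
    IsPartialIsometry ρ' ρ (D.map (LinearEquiv.prodComm ℂ E E').toLinearMap) where
  invariant := by
    rintro x _ ⟨d, hd, rfl⟩
    exact ⟨_, hD.invariant x d hd, rfl⟩
  inner_eq := by
    rintro _ ⟨c, hc, rfl⟩ _ ⟨d, hd, rfl⟩
    exact (hD.inner_eq c hc d hd).symm

theorem map_fst_map_prodComm (D : Submodule ℂ (E × E')) :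
    (D.map (LinearEquiv.prodComm ℂ E E').toLinearMap).map (LinearMap.fst ℂ E' E) =
      D.map (LinearMap.snd ℂ E E') := by
  rw [← Submodule.map_comp]; rfl

theorem IsPartialIsometry.snd_eq_zero {D : Submodule ℂ (E × E')}
    (hD : IsPartialIsometry ρ ρ' D) {d : E × E'} (hd : d ∈ D) (h : d.1 = 0) : d.2 = 0 := by
  rw [← inner_self_eq_zero (𝕜 := ℂ), ← hD.inner_eq d hd d hd, h, inner_zero_left]

theorem IsPartialIsometry.fst_eq_zero {D : Submodule ℂ (E × E')}
    (hD : IsPartialIsometry ρ ρ' D) {d : E × E'} (hd : d ∈ D) (h : d.2 = 0) : d.1 = 0 := by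
  rw [← inner_self_eq_zero (𝕜 := ℂ), hD.inner_eq d hd d hd, h, inner_zero_left]

theorem IsPartialIsometry.sup {C D : Submodule ℂ (E × E')} (hC : IsPartialIsometry ρ ρ' C)
    (hD : IsPartialIsometry ρ ρ' D)
    (h₁ : ∀ c ∈ C, ∀ d ∈ D, inner ℂ c.1 d.1 = 0) (h₂ : ∀ c ∈ C, ∀ d ∈ D, inner ℂ c.2 d.2 = 0) :
    IsPartialIsometry ρ ρ' (C ⊔ D) where
  invariant := by
    intro x z hz
    obtain ⟨c, hc, d, hd, rfl⟩ := Submodule.mem_sup.1 hz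
    exact Submodule.mem_sup.2 ⟨_, hC.invariant x c hc, _, hD.invariant x d hd, by simp⟩
  inner_eq := by
    intro z hz z' hz'
    obtain ⟨c, hc, d, hd, rfl⟩ := Submodule.mem_sup.1 hz
    obtain ⟨c', hc', d', hd', rfl⟩ := Submodule.mem_sup.1 hz'
    have k₁ : inner ℂ d.1 c'.1 = 0 := by rw [← inner_conj_symm, h₁ _ hc' _ hd, map_zero]
    have k₂ : inner ℂ d.2 c'.2 = 0 := by rw [← inner_conj_symm, h₂ _ hc' _ hd, map_zero]
    simp [hC.inner_eq c hc c' hc', hD.inner_eq d hd d' hd', h₁ c hc d' hd', h₂ c hc d' hd', k₁, k₂]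

/-! ### Cyclic submodules generated by a pair of highest weight vectors -/

/-- The smallest subspace of `E × E'` that contains `w` and is stable under the lowering
operators. -/
def TriangularData.cyclic (T : TriangularData 𝔤) (ρ : 𝔤 →ₗ[ℂ] Module.End ℂ E)
    (ρ' : 𝔤 →ₗ[ℂ] Module.End ℂ E') (w : E × E') : Submodule ℂ (E × E') :=
  sInf {p | w ∈ p ∧ ∀ r, ∀ d ∈ p, (ρ (T.conj (T.e r)) d.1, ρ' (T.conj (T.e r)) d.2) ∈ p}

theorem TriangularData.self_mem_cyclic (w : E × E') : w ∈ T.cyclic ρ ρ' w :=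
  Submodule.mem_sInf.2 fun _ hp => hp.1

theorem TriangularData.lower_mem_cyclic {w d : E × E'} (hd : d ∈ T.cyclic ρ ρ' w) (r : T.Root) :
    (ρ (T.conj (T.e r)) d.1, ρ' (T.conj (T.e r)) d.2) ∈ T.cyclic ρ ρ' w :=
  Submodule.mem_sInf.2 fun p hp => hp.2 r d (Submodule.mem_sInf.1 hd p hp)

theorem TriangularData.cyclic_le {w : E × E'} {p : Submodule ℂ (E × E')} (hw : w ∈ p)
    (hp : ∀ r, ∀ d ∈ T.cyclic ρ ρ' w, d ∈ p →
      (ρ (T.conj (T.e r)) d.1, ρ' (T.conj (T.e r)) d.2) ∈ p) : T.cyclic ρ ρ' w ≤ p := by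
  have : T.cyclic ρ ρ' w ≤ p ⊓ T.cyclic ρ ρ' w :=
    sInf_le ⟨⟨hw, T.self_mem_cyclic w⟩, fun r d hd => ⟨hp r d hd.2 hd.1, T.lower_mem_cyclic hd.2 r⟩⟩
  exact this.trans inf_le_left

/-- The action on the direct sum. -/
def prodRep (ρ : 𝔤 →ₗ[ℂ] Module.End ℂ E) (ρ' : 𝔤 →ₗ[ℂ] Module.End ℂ E') (x : 𝔤) :
    Module.End ℂ (E × E') := (ρ x).prodMap (ρ' x)

/-- Moving x past a lowering operator costs only a commutator, which is again an algebra element.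
Treating all x at once therefore closes the induction, without ordered monomials or the Jacobi
identity. -/
theorem TriangularData.cyclic_invariant (hρ : T.IsUnitaryRep ρ) (hρ' : T.IsUnitaryRep ρ')
    {a b : ℂ} {v : E} {v' : E'} (hv : v ∈ T.weightSpace ρ a b) (hv' : v' ∈ T.weightSpace ρ' a b)
    (hev : ∀ r, ρ (T.e r) v = 0) (hev' : ∀ r, ρ' (T.e r) v' = 0) :
    ∀ x, ∀ d ∈ T.cyclic ρ ρ' (v, v'), (ρ x d.1, ρ' x d.2) ∈ T.cyclic ρ ρ' (v, v') := by
  set D := T.cyclic ρ ρ' (v, v') with hDdef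
  have key : D ≤ ⨅ x, D.comap (prodRep ρ ρ' x) := by
    apply T.cyclic_le
    · rw [Submodule.mem_iInf]
      intro x
      change (ρ x v, ρ' x v') ∈ D
      rw [T.mem_weightSpace] at hv hv'
      have hmem : ∀ c : ℂ, (c • v, c • v') ∈ D := fun c => D.smul_mem c (T.self_mem_cyclic _)
      induction T.mem_span x using Submodule.span_induction with
      | mem x hx =>
        rcases hx with (hx | ⟨r, rfl⟩) | ⟨r, rfl⟩
        · rcases hx with rfl | rfl
          · rw [hv.1, hv'.1]; exact hmem a
          · rw [hv.2, hv'.2]; exact hmem b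
        · rw [hev, hev']; exact D.zero_mem
        · exact T.lower_mem_cyclic (T.self_mem_cyclic (v, v')) r
      | zero => simp only [map_zero, LinearMap.zero_apply]; exact D.zero_mem
      | add x y _ _ hx hy => simpa using D.add_mem hx hy
      | smul c x _ hx => simpa using D.smul_mem c hx
    · intro r d hd hd'
      rw [Submodule.mem_iInf] at hd' ⊢
      intro x
      change (ρ x (ρ _ d.1), ρ' x (ρ' _ d.2)) ∈ D
      rw [hρ.map_bracket, hρ'.map_bracket]
      exact D.add_mem (T.lower_mem_cyclic (hd' x) r) (hd' _)
  intro x d hd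
  exact (Submodule.mem_iInf _).1 (key hd) x

theorem TriangularData.isPartialIsometry_cyclic (hρ : T.IsUnitaryRep ρ) (hρ' : T.IsUnitaryRep ρ')
    {a b : ℂ} {v : E} {v' : E'} (hv : v ∈ T.weightSpace ρ a b) (hv' : v' ∈ T.weightSpace ρ' a b)
    (hev : ∀ r, ρ (T.e r) v = 0) (hev' : ∀ r, ρ' (T.e r) v' = 0)
    (hvv : inner ℂ v v = inner ℂ v' v') : IsPartialIsometry ρ ρ' (T.cyclic ρ ρ' (v, v')) where
  invariant := T.cyclic_invariant hρ hρ' hv hv' hev hev'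
  inner_eq := by
    set D := T.cyclic ρ ρ' (v, v') with hDdef
    have hinv := T.cyclic_invariant hρ hρ' hv hv' hev hev'
    -- First pair with the highest weight vectors: a lowering operator moved across becomes a
    -- raising operator, which kills them, so both sides vanish.
    have base : ∀ d ∈ D, inner ℂ v d.1 = inner ℂ v' d.2 := by
      let p : Submodule ℂ (E × E') := LinearMap.ker
        ((innerₛₗ ℂ v).comp (LinearMap.fst ℂ E E') - (innerₛₗ ℂ v').comp (LinearMap.snd ℂ E E'))
      have hp : ∀ d, d ∈ p ↔ inner ℂ v d.1 = inner ℂ v' d.2 := by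
        intro d; simp [p, sub_eq_zero]
      have : D ≤ p := by
        apply T.cyclic_le
        · exact (hp _).2 hvv
        · intro r d _ _
          rw [hp, ← hρ.inner_map, ← hρ'.inner_map, hev, hev', inner_zero_left, inner_zero_left]
      exact fun d hd => (hp d).1 (this hd)
    -- Now induct on the left argument: its lowering operator moves across to the right one, which
    -- stays in D by invariance.
    let q : Submodule ℂ (E × E') :=
      { carrier := {c | ∀ d ∈ D, inner ℂ c.1 d.1 = inner ℂ c.2 d.2}
        zero_mem' := by intro d _; simp
        add_mem' := by
          intro c c' hc hc' d hd
          simp [hc d hd, hc' d hd]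
        smul_mem' := by
          intro k c hc d hd
          simp [hc d hd] }
    have : D ≤ q := by
      apply T.cyclic_le
      · exact base
      · intro r c _ hc d hd
        change inner ℂ (ρ _ c.1) d.1 = inner ℂ (ρ' _ c.2) d.2
        rw [hρ.inner_map_conj, hρ'.inner_map_conj]
        exact hc _ (hinv _ d hd)
    exact fun c hc d hd => this hc d hd

/-! ### Weights of complements and the maximality argument -/

theorem exists_eigenvector_mem [FiniteDimensional ℂ E] (f : Module.End ℂ E) {W : Submodule ℂ E}
    (hW : W ≠ ⊥) (hf : ∀ u ∈ W, f u ∈ W) : ∃ a, f.eigenspace a ⊓ W ≠ ⊥ := by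
  have : Nontrivial W := Submodule.nontrivial_iff_ne_bot.2 hW
  obtain ⟨a, ha⟩ := Module.End.exists_eigenvalue (f.restrict hf)
  obtain ⟨u, hu⟩ := ha.exists_hasEigenvector
  refine ⟨a, (Submodule.ne_bot_iff _).2 ⟨u, ⟨?_, u.2⟩, by simpa using hu.2⟩⟩
  rw [SetLike.mem_coe, Module.End.mem_eigenspace_iff]
  simpa using congrArg Subtype.val hu.apply_eq_smul

theorem TriangularData.IsUnitaryRep.exists_weightSpace_inf_ne_bot [FiniteDimensional ℂ E]
    (hρ : T.IsUnitaryRep ρ) {W : Submodule ℂ E} (hW : W ≠ ⊥) (hinv : IsInvariant ρ W) :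
    ∃ a b, T.weightSpace ρ a b ⊓ W ≠ ⊥ := by
  obtain ⟨b, hb⟩ := exists_eigenvector_mem (ρ T.h₂) hW (hinv _)
  obtain ⟨a, ha⟩ := exists_eigenvector_mem (ρ T.h₁) hb (by
    rintro u ⟨hu, huW⟩
    refine ⟨?_, hinv _ _ huW⟩
    rw [SetLike.mem_coe, Module.End.mem_eigenspace_iff] at hu ⊢
    have := hρ.map_bracket T.h₁ T.h₂ u
    rw [T.bracket_h₁_h₂, hu] at this
    simpa using this.symm)
  exact ⟨a, b, by rwa [weightSpace, inf_assoc]⟩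

theorem TriangularData.exists_highest_weight [FiniteDimensional ℂ E]
    (hρ : T.IsUnitaryRep ρ) {W : Submodule ℂ E} (hW : W ≠ ⊥) (hinv : IsInvariant ρ W) :
    ∃ a b, T.weightSpace ρ a b ⊓ W ≠ ⊥ ∧
      ∀ a' b', T.height a b < T.height a' b' → T.weightSpace ρ a' b' ⊓ W = ⊥ := by
  let S : Set (ℂ × ℂ) := {z | T.weightSpace ρ z.1 z.2 ⊓ W ≠ ⊥}
  have hfin : S.Finite := by
    refine ((Module.End.finite_hasEigenvalue (ρ T.h₁)).prod
      (Module.End.finite_hasEigenvalue (ρ T.h₂))).subset ?_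
    intro z hz
    refine ⟨fun h => hz ?_, fun h => hz ?_⟩ <;> simp only [weightSpace]
    · rw [Module.End.eigenspace, h, bot_inf_eq, bot_inf_eq]
    · conv_lhs => rw [inf_comm ((ρ T.h₁).eigenspace _), Module.End.eigenspace, h]
      rw [bot_inf_eq, bot_inf_eq]
  obtain ⟨a, b, hab⟩ := hρ.exists_weightSpace_inf_ne_bot hW hinv
  obtain ⟨z, hz, hmax⟩ := Set.exists_max_image S (fun z => T.height z.1 z.2) hfin ⟨(a, b), hab⟩
  refine ⟨z.1, z.2, hz, fun a' b' h => ?_⟩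
  by_contra hne
  exact absurd (hmax (a', b') hne) (not_le.2 h)

/-- Agreement of inner products makes D the graph of an injective intertwiner, which carries weight
vectors to weight vectors. The reverse inequality comes from swapping the factors. -/
theorem IsPartialIsometry.finrank_weightSpace_inf [FiniteDimensional ℂ E] [FiniteDimensional ℂ E']
    {D : Submodule ℂ (E × E')} (hD : IsPartialIsometry ρ ρ' D) (a b : ℂ) :
    Module.finrank ℂ ↥(T.weightSpace ρ a b ⊓ D.map (LinearMap.fst ℂ E E')) ≤
      Module.finrank ℂ ↥(T.weightSpace ρ' a b ⊓ D.map (LinearMap.snd ℂ E E')) := by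
  let F : Submodule ℂ (E × E') := (T.weightSpace ρ a b).comap (LinearMap.fst ℂ E E') ⊓ D
  have hker : ∀ x (c : ℂ), ∀ d ∈ D, ρ x d.1 = c • d.1 → ρ' x d.2 = c • d.2 := by
    intro x c d hd h
    have := hD.snd_eq_zero (D.sub_mem (hD.invariant x d hd) (D.smul_mem c hd)) (by simp [h])
    simpa [sub_eq_zero] using this
  have h₁ : T.weightSpace ρ a b ⊓ D.map (LinearMap.fst ℂ E E') =
      F.map (LinearMap.fst ℂ E E') := by
    ext u
    constructor
    · rintro ⟨hu, d, hd, rfl⟩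
      exact ⟨d, ⟨hu, hd⟩, rfl⟩
    · rintro ⟨d, ⟨hu, hd⟩, rfl⟩
      exact ⟨hu, d, hd, rfl⟩
  have h₂ : F.map (LinearMap.snd ℂ E E') ≤
      T.weightSpace ρ' a b ⊓ D.map (LinearMap.snd ℂ E E') := by
    rintro _ ⟨d, ⟨hu, hd⟩, rfl⟩
    have hu := T.mem_weightSpace.1 (Submodule.mem_comap.1 hu)
    exact ⟨T.mem_weightSpace.2 ⟨hker _ _ d hd hu.1, hker _ _ d hd hu.2⟩, d, hd, rfl⟩
  have h₃ : Module.finrank ℂ (F.map (LinearMap.snd ℂ E E')) = Module.finrank ℂ F := by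
    rw [← LinearMap.range_domRestrict]
    refine LinearMap.finrank_range_of_inj ((injective_iff_map_eq_zero _).2 ?_)
    rintro ⟨d, hd⟩ h
    exact Subtype.ext (Prod.ext (hD.fst_eq_zero hd.2 h) h)
  rw [h₁]
  exact (Submodule.finrank_map_le _ _).trans (h₃.symm.le.trans (Submodule.finrank_mono h₂))

/-- Both W and its complement are invariant, so the complementary component of a weight vector has
the same weight. -/
theorem TriangularData.IsUnitaryRep.weightSpace_le [FiniteDimensional ℂ E]
    (hρ : T.IsUnitaryRep ρ) {W : Submodule ℂ E} (hW : IsInvariant ρ W) {a b : ℂ}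
    (h : T.weightSpace ρ a b ⊓ Wᗮ = ⊥) : T.weightSpace ρ a b ≤ W := by
  intro u hu
  obtain ⟨p, hp, q, hq, rfl⟩ := W.exists_add_mem_mem_orthogonal u
  have hq' := hρ.isInvariant_orthogonal hW
  have key : ∀ x (c : ℂ), ρ x (p + q) = c • (p + q) → ρ x q = c • q := by
    intro x c hx
    have h₁ : ρ x q - c • q ∈ Wᗮ := Wᗮ.sub_mem (hq' x q hq) (Wᗮ.smul_mem c hq)
    have h₂ : ρ x q - c • q = c • p - ρ x p := by
      rw [map_add, smul_add] at hx
      rw [sub_eq_sub_iff_add_eq_add, add_comm, hx]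
    have h₃ : ρ x q - c • q ∈ W := by
      rw [h₂]; exact W.sub_mem (W.smul_mem c hp) (hW x p hp)
    exact sub_eq_zero.1 ((Submodule.mem_bot ℂ).1 (W.inf_orthogonal_eq_bot ▸ ⟨h₃, h₁⟩))
  rw [T.mem_weightSpace] at hu
  have : q ∈ T.weightSpace ρ a b ⊓ Wᗮ :=
    ⟨T.mem_weightSpace.2 ⟨key _ _ hu.1, key _ _ hu.2⟩, hq⟩
  rw [h, Submodule.mem_bot] at this
  rw [this, add_zero]
  exact hp

theorem IsPartialIsometry.weightSpace_inf_orthogonal_eq_bot [FiniteDimensional ℂ E]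
    [FiniteDimensional ℂ E'] (hρ : T.IsUnitaryRep ρ)
    {D : Submodule ℂ (E × E')} (hD : IsPartialIsometry ρ ρ' D) {a b : ℂ}
    (hdim : Module.finrank ℂ (T.weightSpace ρ a b) = Module.finrank ℂ (T.weightSpace ρ' a b))
    (h : T.weightSpace ρ a b ⊓ (D.map (LinearMap.fst ℂ E E'))ᗮ = ⊥) :
    T.weightSpace ρ' a b ⊓ (D.map (LinearMap.snd ℂ E E'))ᗮ = ⊥ := by
  have h₁ := hD.finrank_weightSpace_inf (T := T) a b
  rw [inf_eq_left.2 (hρ.weightSpace_le hD.isInvariant_map_fst h), hdim] at h₁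
  have h₂ := Submodule.eq_of_le_of_finrank_le inf_le_left h₁
  have h₃ := inf_eq_left.1 h₂
  exact le_bot_iff.1 ((inf_le_inf_right _ h₃).trans (Submodule.inf_orthogonal_eq_bot _).le)

theorem map_fst_eq_top_of_maximal [FiniteDimensional ℂ E] [FiniteDimensional ℂ E']
    (hρ : T.IsUnitaryRep ρ) (hρ' : T.IsUnitaryRep ρ')
    (hdim : ∀ a b, Module.finrank ℂ (T.weightSpace ρ a b) =
      Module.finrank ℂ (T.weightSpace ρ' a b))
    {D : Submodule ℂ (E × E')} (hD : IsPartialIsometry ρ ρ' D)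
    (hmax : ∀ C, IsPartialIsometry ρ ρ' C → D ≤ C → C ≤ D) :
    D.map (LinearMap.fst ℂ E E') = ⊤ := by
  set W := D.map (LinearMap.fst ℂ E E') with hW
  set W' := D.map (LinearMap.snd ℂ E E') with hW'
  have hWinv : IsInvariant ρ W := hD.isInvariant_map_fst
  have hW'inv : IsInvariant ρ' W' := by
    have := hD.swap.isInvariant_map_fst
    rwa [map_fst_map_prodComm] at this
  have hiff : ∀ a b, T.weightSpace ρ a b ⊓ Wᗮ = ⊥ ↔ T.weightSpace ρ' a b ⊓ W'ᗮ = ⊥ := by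
    intro a b
    refine ⟨hD.weightSpace_inf_orthogonal_eq_bot hρ (hdim a b), fun h => ?_⟩
    have := hD.swap.weightSpace_inf_orthogonal_eq_bot (T := T) hρ' (hdim a b).symm
      (by rwa [map_fst_map_prodComm])
    rwa [← Submodule.map_comp] at this
  rw [← Submodule.orthogonal_eq_bot_iff]
  by_contra hne
  obtain ⟨a, b, hab, htop⟩ :=
    T.exists_highest_weight hρ hne (hρ.isInvariant_orthogonal hWinv)
  have hab' := (hiff a b).not.1 hab
  obtain ⟨v, ⟨hv, hvW⟩, hv0⟩ := (Submodule.ne_bot_iff _).1 hab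
  obtain ⟨v', ⟨hv', hvW'⟩, hv0'⟩ := (Submodule.ne_bot_iff _).1 hab'
  -- Normalising gives the two vectors equal length, as the cyclic construction requires.
  let u : E := ((‖v‖⁻¹ : ℝ) : ℂ) • v
  let u' : E' := ((‖v'‖⁻¹ : ℝ) : ℂ) • v'
  have hu : u ∈ T.weightSpace ρ a b := Submodule.smul_mem _ _ hv
  have hu' : u' ∈ T.weightSpace ρ' a b := Submodule.smul_mem _ _ hv'
  have huW : u ∈ Wᗮ := Submodule.smul_mem _ _ hvW
  have huW' : u' ∈ W'ᗮ := Submodule.smul_mem _ _ hvW'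
  have hu1 : ‖u‖ = 1 := by simp [u, norm_smul, hv0]
  have hu1' : ‖u'‖ = 1 := by simp [u', norm_smul, hv0']
  have heu : ∀ r, ρ (T.e r) u = 0 := by
    intro r
    have h : ρ (T.e r) u ∈ T.weightSpace ρ (a + T.α r) (b + T.β r) ⊓ Wᗮ :=
      ⟨hρ.map_e_mem_weightSpace r hu, hρ.isInvariant_orthogonal hWinv _ _ huW⟩
    rwa [htop _ _ (T.height_lt r a b), Submodule.mem_bot] at h
  have heu' : ∀ r, ρ' (T.e r) u' = 0 := by
    intro r
    have h : ρ' (T.e r) u' ∈ T.weightSpace ρ' (a + T.α r) (b + T.β r) ⊓ W'ᗮ :=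
      ⟨hρ'.map_e_mem_weightSpace r hu', hρ'.isInvariant_orthogonal hW'inv _ _ huW'⟩
    -- The height was maximised only in the complement in E; `hiff` transfers the vanishing of
    -- higher weight spaces to E'.
    rwa [(hiff _ _).1 (htop _ _ (T.height_lt r a b)), Submodule.mem_bot] at h
  have hC := T.isPartialIsometry_cyclic hρ hρ' hu hu' heu heu'
    (by rw [inner_self_eq_norm_sq_to_K, inner_self_eq_norm_sq_to_K, hu1, hu1'])
  have hCle : T.cyclic ρ ρ' (u, u') ≤ Wᗮ.prod W'ᗮ := by
    refine T.cyclic_le ⟨huW, huW'⟩ fun r d _ hd => ?_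
    exact ⟨hρ.isInvariant_orthogonal hWinv _ _ hd.1, hρ'.isInvariant_orthogonal hW'inv _ _ hd.2⟩
  have hsup := hD.sup hC
    (fun c hc d hd => (hCle hd).1 _ ⟨c, hc, rfl⟩) (fun c hc d hd => (hCle hd).2 _ ⟨c, hc, rfl⟩)
  have hmem : (u, u') ∈ D := hmax _ hsup le_sup_left
    (Submodule.mem_sup_right (T.self_mem_cyclic _))
  have : u = 0 := by
    rw [← inner_self_eq_zero (𝕜 := ℂ)]
    exact huW u ⟨_, hmem, rfl⟩
  simp [this] at hu1

/-- Two unitary representations with the same weight multiplicities are isometrically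
isomorphic. -/
theorem TriangularData.exists_isometryEquiv [FiniteDimensional ℂ E] [FiniteDimensional ℂ E']
    (hρ : T.IsUnitaryRep ρ) (hρ' : T.IsUnitaryRep ρ')
    (hdim : ∀ a b, Module.finrank ℂ (T.weightSpace ρ a b) =
      Module.finrank ℂ (T.weightSpace ρ' a b)) :
    ∃ U : E ≃ₗᵢ[ℂ] E', ∀ x u, U (ρ x u) = ρ' x (U u) := by
  obtain ⟨D, hD, hmax⟩ : ∃ D : Submodule ℂ (E × E'), IsPartialIsometry ρ ρ' D ∧
      ∀ C, IsPartialIsometry ρ ρ' C → D ≤ C → C ≤ D := by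
    have hbot : IsPartialIsometry ρ ρ' ⊥ :=
      ⟨fun x d hd => by rw [(Submodule.mem_bot ℂ).1 hd]; simp,
        fun c hc d hd => by rw [(Submodule.mem_bot ℂ).1 hd]; simp⟩
    obtain ⟨D, hD⟩ := exists_maximal_of_wellFoundedGT (IsPartialIsometry ρ ρ') ⟨⊥, hbot⟩
    exact ⟨D, hD.1, fun C hC h => hD.2 hC h⟩
  have h₁ := map_fst_eq_top_of_maximal hρ hρ' hdim hD hmax
  have h₂ : D.map (LinearMap.snd ℂ E E') = ⊤ := by
    have := map_fst_eq_top_of_maximal hρ' hρ (fun a b => (hdim a b).symm) hD.swap (by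
      intro C hC hle
      have h := hmax _ hC.swap fun d hd => ⟨(d.2, d.1), hle ⟨d, hd, rfl⟩, rfl⟩
      exact fun c hc => ⟨(c.2, c.1), h ⟨c, hc, rfl⟩, rfl⟩)
    rwa [map_fst_map_prodComm] at this
  have hex : ∀ u, ∃ u', (u, u') ∈ D := by
    intro u
    obtain ⟨d, hd, rfl⟩ : u ∈ D.map (LinearMap.fst ℂ E E') := h₁ ▸ Submodule.mem_top
    exact ⟨d.2, hd⟩
  choose f hf using hex
  have huniq : ∀ {u u' w'}, (u, u') ∈ D → (u, w') ∈ D → u' = w' := by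
    intro u u' w' h h'
    have := hD.snd_eq_zero (D.sub_mem h h') (by simp)
    simpa [sub_eq_zero] using this
  let F : E →ₗᵢ[ℂ] E' :=
    LinearMap.isometryOfInner
      { toFun := f
        map_add' := fun u v => huniq (hf (u + v)) (D.add_mem (hf u) (hf v))
        map_smul' := fun c u => huniq (hf (c • u)) (D.smul_mem c (hf u)) }
      (fun u v => (hD.inner_eq _ (hf u) _ (hf v)).symm)
  have hF : Function.Surjective F := by
    intro u'
    obtain ⟨d, hd, rfl⟩ : u' ∈ D.map (LinearMap.snd ℂ E E') := h₂ ▸ Submodule.mem_top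
    exact ⟨d.1, huniq (hf _) hd⟩
  exact ⟨LinearIsometryEquiv.ofSurjective F hF, fun x u =>
    huniq (hf (ρ x u)) (hD.invariant x _ (hf u))⟩

end

attribute [local instance] LieRing.ofAssociativeRing LieAlgebra.ofAssociativeAlgebra

/-! ### Hermiticity of the generators -/

section Trace

open scoped ComplexOrder

variable {n : Type*} [Fintype n]

theorem eq_zero_of_trace_conjTranspose_mul_self_re_nonpos {X : Matrix n n ℂ}
    (h : (Xᴴ * X).trace.re ≤ 0) : X = 0 := by
  have h₁ := Complex.nonneg_iff.1 (Matrix.posSemidef_conjTranspose_mul_self X).trace_nonneg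
  exact Matrix.trace_conjTranspose_mul_self_eq_zero_iff.1
    (Complex.ext (le_antisymm h h₁.1) h₁.2.symm)

/-- If X is anti-Hermitian, tr X†X = -tr X² has nonpositive real part, so X = 0, which is Hermitian
as well. -/
theorem HOrAH.conjTranspose_eq {X : Matrix n n ℂ} (hX : HOrAH X) (h : 0 ≤ (X * X).trace.re) :
    Xᴴ = X := by
  refine hX.elim id fun hX => ?_
  have : X = 0 := eq_zero_of_trace_conjTranspose_mul_self_re_nonpos (by simpa [hX] using h)
  simp [this]

theorem HOrAH.conjTranspose_eq_neg {X : Matrix n n ℂ} (hX : HOrAH X)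
    (h : (X * X).trace.re ≤ 0) : Xᴴ = -X := by
  refine hX.elim (fun hX => ?_) id
  have : X = 0 := eq_zero_of_trace_conjTranspose_mul_self_re_nonpos (by simpa [hX] using h)
  simp [this]

/-- Invariance of the trace form. -/
theorem smul_trace_mul_self_eq [DecidableEq n] {X Y Z : Matrix n n ℂ} {a b : ℂ}
    (h₁ : ⁅X, Y⁆ = a • Z) (h₂ : ⁅Y, Z⁆ = b • X) : a * (Z * Z).trace = b * (X * X).trace := by
  have h : (⁅X, Y⁆ * Z).trace = (X * ⁅Y, Z⁆).trace := by
    rw [Ring.lie_def, Ring.lie_def, sub_mul, mul_sub, Matrix.trace_sub, Matrix.trace_sub,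
      ← Matrix.mul_assoc, ← Matrix.mul_assoc, Matrix.trace_mul_cycle X Z Y,
      Matrix.trace_mul_cycle Y X Z, Matrix.trace_mul_cycle Z Y X]
  rw [h₁, h₂] at h
  simpa using h

end Trace

section Hermitian

variable {n : Type*} [Fintype n] [DecidableEq n] {R : Generators n}

theorem Generators.IsDSRep.trace_sq (hR : R.IsDSRep) :
    (∀ i, (R.J i * R.J i).trace = (R.J 2 * R.J 2).trace) ∧
    (∀ i, (R.K i * R.K i).trace = -(R.J 2 * R.J 2).trace) ∧
    (∀ i, (R.V i * R.V i).trace = (R.J 2 * R.J 2).trace) ∧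
    (R.Vt * R.Vt).trace = -(R.J 2 * R.J 2).trace := by
  have hI := Complex.I_ne_zero
  have JJ : ∀ i, ⁅R.J (i + 1), R.J (i + 2)⁆ = Complex.I • R.J i := by
    intro i; rw [hR.JJ]; fin_cases i <;> simp [eps]
  have KK : ∀ i, ⁅R.K (i + 2), R.K i⁆ = (-Complex.I) • R.J (i + 1) := by
    intro i; rw [hR.KK]; fin_cases i <;> simp [eps]
  have JK : ∀ i, ⁅R.J (i + 1), R.K (i + 2)⁆ = Complex.I • R.K i := by
    intro i; rw [hR.JK]; fin_cases i <;> simp [eps]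
  have JV : ∀ i, ⁅R.J (i + 1), R.V (i + 2)⁆ = Complex.I • R.V i := by
    intro i; rw [hR.JV]; fin_cases i <;> simp [eps]
  have VV : ∀ i, ⁅R.V (i + 2), R.V i⁆ = Complex.I • R.J (i + 1) := by
    intro i; rw [hR.VV]; fin_cases i <;> simp [eps]
  have JJ' : ∀ i, ⁅R.J (i + 2), R.J i⁆ = Complex.I • R.J (i + 1) := by
    intro i; rw [hR.JJ]; fin_cases i <;> simp [eps]
  have VK : ⁅R.V 0, R.K 0⁆ = Complex.I • R.Vt := by
    rw [← lie_skew, hR.KV]; simp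
  have KVt : ⁅R.K 0, R.Vt⁆ = (-Complex.I) • R.V 0 := by
    rw [hR.KVt, neg_smul]
  have hJ : ∀ i, (R.J i * R.J i).trace = (R.J (i + 1) * R.J (i + 1)).trace := fun i =>
    mul_left_cancel₀ hI (smul_trace_mul_self_eq (JJ i) (JJ' i))
  have hJ' : ∀ i, (R.J i * R.J i).trace = (R.J 2 * R.J 2).trace := by
    intro i
    fin_cases i
    · exact (hJ 0).trans (hJ 1)
    · exact hJ 1
    · rfl
  have hV : ∀ i, (R.V i * R.V i).trace = (R.J 2 * R.J 2).trace := fun i =>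
    (mul_left_cancel₀ hI (smul_trace_mul_self_eq (JV i) (VV i))).trans (hJ' _)
  refine ⟨hJ', fun i => ?_, hV, ?_⟩
  · rw [← hJ' (i + 1)]
    refine mul_left_cancel₀ hI ?_
    rw [smul_trace_mul_self_eq (JK i) (KK i), neg_mul, mul_neg]
  · rw [← hV 0]
    refine mul_left_cancel₀ hI ?_
    rw [smul_trace_mul_self_eq VK KVt, neg_mul, mul_neg]

theorem Generators.IsDSRep.conjTranspose_eq (hR : R.IsDSRep) (hH : R.IsHOrAH) :
    (∀ i, (R.J i)ᴴ = R.J i) ∧ (∀ i, (R.K i)ᴴ = -R.K i) ∧ (∀ i, (R.V i)ᴴ = R.V i) ∧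
      (R.Vt)ᴴ = -R.Vt := by
  obtain ⟨hJ, hK, hV, hVt⟩ := hR.trace_sq
  -- Otherwise all J_i are anti-Hermitian. Then [J_x, J_y] is anti-Hermitian but iJ_z is Hermitian,
  -- so J_z = 0 and its trace square is not negative.
  have hpos : 0 ≤ (R.J 2 * R.J 2).trace.re := by
    by_contra! hneg
    have hanti : ∀ i, (R.J i)ᴴ = -R.J i := fun i =>
      (hH.J i).conjTranspose_eq_neg (by rw [hJ]; exact hneg.le)
    have h : ⁅R.J 0, R.J 1⁆ = Complex.I • R.J 2 := by
      rw [hR.JJ]; simp [eps]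
    have h' := congrArg Matrix.conjTranspose h
    rw [Ring.lie_def] at h h'
    simp only [Matrix.conjTranspose_sub, Matrix.conjTranspose_mul, hanti, neg_mul_neg,
      Matrix.conjTranspose_smul, Complex.star_def, Complex.conj_I, smul_neg, neg_smul,
      neg_neg] at h'
    rw [← h] at h'
    have h₂ : Complex.I • R.J 2 = 0 := by
      rw [← h]
      have : (2 : ℂ) • (R.J 0 * R.J 1 - R.J 1 * R.J 0) = 0 := by
        rw [two_smul]; nth_rewrite 1 [← h']; abel
      exact (smul_eq_zero.1 this).resolve_left two_ne_zero
    rw [(smul_eq_zero.1 h₂).resolve_left Complex.I_ne_zero] at hneg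
    simp at hneg
  refine ⟨fun i => (hH.J i).conjTranspose_eq ?_, fun i => (hH.K i).conjTranspose_eq_neg ?_,
    fun i => (hH.V i).conjTranspose_eq ?_, hH.Vt.conjTranspose_eq_neg ?_⟩
  · rwa [hJ]
  · rw [hK]; simpa using hpos
  · rwa [hV]
  · rw [hVt]; simpa using hpos

end Hermitian

/-! ### The de Sitter algebra in coordinates -/

/-- The coordinates of an element of the de Sitter algebra with respect to `J, K, V, V_t`. -/
abbrev Coord : Type := (Fin 3 → ℂ) × (Fin 3 → ℂ) × (Fin 3 → ℂ) × ℂ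

/-- The Lie bracket in coordinates. -/
def Coord.bracket (x y : Coord) : Coord :=
  (Complex.I • (x.1 ⨯₃ y.1 - x.2.1 ⨯₃ y.2.1 + x.2.2.1 ⨯₃ y.2.2.1),
    Complex.I • (x.1 ⨯₃ y.2.1 + x.2.1 ⨯₃ y.1 + (x.2.2.2 • y.2.2.1 - y.2.2.2 • x.2.2.1)),
    Complex.I • (x.1 ⨯₃ y.2.2.1 + x.2.2.1 ⨯₃ y.1 + (x.2.2.2 • y.2.1 - y.2.2.2 • x.2.1)),
    Complex.I * (x.2.2.1 ⬝ᵥ y.2.1 - x.2.1 ⬝ᵥ y.2.2.1))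

/-- The conjugation in coordinates. -/
def Coord.conj (x : Coord) : Coord :=
  (fun i => star (x.1 i), fun i => -star (x.2.1 i), fun i => star (x.2.2.1 i), -star x.2.2.2)

/-- The coordinates of `J_z`. -/
def Coord.jz : Coord := (![0, 0, 1], 0, 0, 0)

/-- The coordinates of `K_z`. -/
def Coord.kz : Coord := (0, ![0, 0, 1], 0, 0)

/-- The positive root vectors. -/
def Coord.posRoot : Fin 4 → Coord :=
  ![(![1, Complex.I, 0], ![Complex.I, -1, 0], 0, 0), (![1, Complex.I, 0], ![-Complex.I, 1, 0], 0, 0),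
    (0, 0, ![1, Complex.I, 0], 0), (0, 0, ![0, 0, 1], 1)]

/-- The four vectors are 2A⁺, 2B⁺, V_x + iV_y and V_z + V_t. In eigenvalues of (J_z, iK_z) the roots
are (1,1), (1,-1), (1,0), (0,1), the positive roots of B₂. -/
theorem Coord.bracket_posRoot_J (r : Fin 4) :
    Coord.bracket Coord.jz (Coord.posRoot r) =
      (![1, 1, 1, 0] : Fin 4 → ℂ) r • Coord.posRoot r := by
  fin_cases r <;> ext i <;> (try fin_cases i) <;>
    simp [Coord.bracket, Coord.jz, Coord.posRoot, crossProduct, dotProduct]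

theorem Coord.bracket_posRoot_K (r : Fin 4) :
    Coord.bracket Coord.kz (Coord.posRoot r) =
      (![-Complex.I, Complex.I, 0, -Complex.I] : Fin 4 → ℂ) r • Coord.posRoot r := by
  fin_cases r <;> ext i <;> (try fin_cases i) <;>
    simp [Coord.bracket, Coord.kz, Coord.posRoot, crossProduct, dotProduct, Fin.sum_univ_three]

theorem Coord.conj_posRoot (r : Fin 4) : Coord.conj (Coord.posRoot r) =
    (![(![1, -Complex.I, 0], ![Complex.I, 1, 0], 0, 0),
      (![1, -Complex.I, 0], ![-Complex.I, -1, 0], 0, 0),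
      (0, 0, ![1, -Complex.I, 0], 0), (0, 0, ![0, 0, 1], -1)] : Fin 4 → Coord) r := by
  fin_cases r <;> ext i <;> (try fin_cases i) <;> simp [Coord.conj, Coord.posRoot]

theorem Coord.mem_span_root (x : Coord) :
    x ∈ Submodule.span ℂ ({Coord.jz, Coord.kz} ∪
      Set.range Coord.posRoot ∪ Set.range fun r => Coord.conj (Coord.posRoot r)) := by
  set S := Submodule.span ℂ ({Coord.jz, Coord.kz} ∪
      Set.range Coord.posRoot ∪ Set.range fun r => Coord.conj (Coord.posRoot r)) with hS
  have h₁ : Coord.jz ∈ S := Submodule.subset_span (by simp)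
  have h₂ : Coord.kz ∈ S := Submodule.subset_span (by simp)
  have h₃ : ∀ r, Coord.posRoot r ∈ S := fun r => Submodule.subset_span (by simp)
  have h₄ : ∀ r, Coord.conj (Coord.posRoot r) ∈ S := fun r => Submodule.subset_span (by simp)
  obtain ⟨j, k, v, t⟩ := x
  have : ((j, k, v, t) : Coord) = j 2 • Coord.jz + k 2 • Coord.kz
      + ((j 0 - Complex.I * j 1 - Complex.I * k 0 - k 1) / 4) • Coord.posRoot 0
      + ((j 0 - Complex.I * j 1 + Complex.I * k 0 + k 1) / 4) • Coord.posRoot 1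
      + ((v 0 - Complex.I * v 1) / 2) • Coord.posRoot 2
      + ((v 2 + t) / 2) • Coord.posRoot 3
      + ((j 0 + Complex.I * j 1 - Complex.I * k 0 + k 1) / 4) • Coord.conj (Coord.posRoot 0)
      + ((j 0 + Complex.I * j 1 + Complex.I * k 0 - k 1) / 4) • Coord.conj (Coord.posRoot 1)
      + ((v 0 + Complex.I * v 1) / 2) • Coord.conj (Coord.posRoot 2)
      + ((v 2 - t) / 2) • Coord.conj (Coord.posRoot 3) := by
    ext i <;> (try fin_cases i) <;> simp [Coord.jz, Coord.kz, Coord.conj_posRoot] <;>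
      simp [Coord.posRoot] <;>
    · ring_nf
      try simp only [Complex.I_sq]
      try ring
  rw [this]
  exact S.add_mem (S.add_mem (S.add_mem (S.add_mem (S.add_mem (S.add_mem (S.add_mem (S.add_mem
    (S.add_mem (S.smul_mem _ h₁) (S.smul_mem _ h₂)) (S.smul_mem _ (h₃ 0))) (S.smul_mem _ (h₃ 1)))
    (S.smul_mem _ (h₃ 2))) (S.smul_mem _ (h₃ 3))) (S.smul_mem _ (h₄ 0))) (S.smul_mem _ (h₄ 1)))
    (S.smul_mem _ (h₄ 2))) (S.smul_mem _ (h₄ 3))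

/-- The triangular decomposition of the de Sitter algebra with respect to `J_z, K_z`. -/
def triangularData : TriangularData Coord where
  bracket := Coord.bracket
  conj := Coord.conj
  h₁ := Coord.jz
  h₂ := Coord.kz
  Root := Fin 4
  e := Coord.posRoot
  α := ![1, 1, 1, 0]
  β := ![-Complex.I, Complex.I, 0, -Complex.I]
  bracket_h₁ := Coord.bracket_posRoot_J
  bracket_h₂ := Coord.bracket_posRoot_K
  bracket_h₁_h₂ := by
    ext i <;> (try fin_cases i) <;> simp [Coord.bracket, Coord.jz, Coord.kz, crossProduct]
  -- The weight 2 on J_z makes even the root (1, i) positive; the four roots have heights 3, 1, 2,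
  -- 1.
  height a b := 2 * a.re - b.im
  height_lt := by
    intro r a b
    fin_cases r <;> simp <;> linarith
  mem_span := Coord.mem_span_root

/-! ### From matrices to a unitary representation of the coordinate algebra -/

section Lin

variable {n : Type*} [Fintype n] [DecidableEq n]

theorem lie_sum_smul_eq_cross {X Y Z : Fin 3 → Matrix n n ℂ}
    (h : ∀ i j, ⁅X i, Y j⁆ = Complex.I • ∑ k, eps i j k • Z k) (a b : Fin 3 → ℂ) :
    ⁅∑ i, a i • X i, ∑ i, b i • Y i⁆ = ∑ i, (Complex.I • (a ⨯₃ b)) i • Z i := by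
  simp only [Fin.sum_univ_three, add_lie, lie_add, smul_lie, lie_smul, h]
  simp [eps, crossProduct]
  module

end Lin

section

variable {n : Type*}

/-- The element of a representation with given coordinates. -/
def Generators.lin (R : Generators n) : Coord →ₗ[ℂ] Matrix n n ℂ where
  toFun x := ∑ i, x.1 i • R.J i + ∑ i, x.2.1 i • R.K i + ∑ i, x.2.2.1 i • R.V i + x.2.2.2 • R.Vt
  map_add' x y := by
    simp only [Prod.fst_add, Prod.snd_add, Pi.add_apply, add_smul, Finset.sum_add_distrib]
    abel
  map_smul' c x := by
    simp [smul_add, Finset.smul_sum, smul_smul]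

theorem Generators.lin_apply (R : Generators n) (x : Coord) :
    R.lin x = ∑ i, x.1 i • R.J i + ∑ i, x.2.1 i • R.K i + ∑ i, x.2.2.1 i • R.V i
      + x.2.2.2 • R.Vt := rfl

theorem Generators.lin_conj (R : Generators n)
    (h : (∀ i, (R.J i)ᴴ = R.J i) ∧ (∀ i, (R.K i)ᴴ = -R.K i) ∧ (∀ i, (R.V i)ᴴ = R.V i) ∧
      (R.Vt)ᴴ = -R.Vt) (x : Coord) : R.lin (Coord.conj x) = (R.lin x)ᴴ := by
  simp [Generators.lin_apply, Coord.conj, Matrix.conjTranspose_sum, h]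

end

section Rep

variable {n : Type*} [Fintype n] [DecidableEq n] {R : Generators n}

theorem Generators.IsDSRep.lie_lin (hR : R.IsDSRep) (x y : Coord) :
    ⁅R.lin x, R.lin y⁆ = R.lin (Coord.bracket x y) := by
  obtain ⟨j, k, v, t⟩ := x
  obtain ⟨j', k', v', t'⟩ := y
  have JJ := lie_sum_smul_eq_cross hR.JJ j j'
  have KK := lie_sum_smul_eq_cross (Z := fun i => -R.J i)
    (fun i j => (hR.KK i j).trans (by simp)) k k'
  have JK := lie_sum_smul_eq_cross hR.JK j k'
  have JK' := lie_sum_smul_eq_cross hR.JK j' k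
  have JV := lie_sum_smul_eq_cross hR.JV j v'
  have JV' := lie_sum_smul_eq_cross hR.JV j' v
  have VV := lie_sum_smul_eq_cross hR.VV v v'
  have KV : ∀ a b : Fin 3 → ℂ, ⁅∑ i, a i • R.K i, ∑ i, b i • R.V i⁆ =
      -(Complex.I * (a ⬝ᵥ b)) • R.Vt := by
    intro a b
    simp only [Fin.sum_univ_three, add_lie, lie_add, smul_lie, lie_smul, hR.KV, dotProduct]
    simp
    module
  have JT : ∀ a : Fin 3 → ℂ, ⁅∑ i, a i • R.J i, R.Vt⁆ = 0 := by
    intro a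
    simp only [Fin.sum_univ_three, add_lie, smul_lie, hR.JVt]
    simp
  have KT : ∀ a : Fin 3 → ℂ, ⁅∑ i, a i • R.K i, R.Vt⁆ = -(Complex.I • ∑ i, a i • R.V i) := by
    intro a
    simp only [Fin.sum_univ_three, add_lie, smul_lie, hR.KVt]
    module
  have TV : ∀ a : Fin 3 → ℂ, ⁅R.Vt, ∑ i, a i • R.V i⁆ = Complex.I • ∑ i, a i • R.K i := by
    intro a
    simp only [Fin.sum_univ_three, lie_add, lie_smul, hR.VtV]
    module
  have KJ := (lie_skew (∑ i, k i • R.K i) (∑ i, j' i • R.J i)).symm.trans (congrArg Neg.neg JK')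
  have VJ := (lie_skew (∑ i, v i • R.V i) (∑ i, j' i • R.J i)).symm.trans (congrArg Neg.neg JV')
  have VK := (lie_skew (∑ i, v i • R.V i) (∑ i, k' i • R.K i)).symm.trans
    (congrArg Neg.neg (KV k' v))
  have TJ := (lie_skew R.Vt (∑ i, j' i • R.J i)).symm.trans (congrArg Neg.neg (JT j'))
  have TK := (lie_skew R.Vt (∑ i, k' i • R.K i)).symm.trans (congrArg Neg.neg (KT k'))
  have VT := (lie_skew (∑ i, v i • R.V i) R.Vt).symm.trans (congrArg Neg.neg (TV v))
  simp only [Generators.lin_apply, add_lie, lie_add, smul_lie, lie_smul, JJ, KK, JK, JV, VV, KV,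
    JT, KT, TV, KJ, VJ, VK, TJ, TK, VT, lie_self]
  simp only [Coord.bracket, crossProduct, dotProduct, Fin.sum_univ_three, Pi.smul_apply,
    Pi.add_apply, Pi.sub_apply, smul_eq_mul, LinearMap.mk₂_apply, Matrix.cons_val]
  module

/-- The action on Euclidean space. -/
def Generators.rep (R : Generators n) : Coord →ₗ[ℂ] Module.End ℂ (EuclideanSpace ℂ n) :=
  Matrix.toEuclideanLin.toLinearMap ∘ₗ R.lin

theorem Generators.rep_apply (R : Generators n) (x : Coord) (u : EuclideanSpace ℂ n) :
    R.rep x u = WithLp.toLp 2 (R.lin x *ᵥ u.ofLp) := rfl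

theorem Generators.IsDSRep.isUnitaryRep (hR : R.IsDSRep) (hH : R.IsHOrAH) :
    triangularData.IsUnitaryRep R.rep where
  map_bracket x y u := by
    change R.rep x (R.rep y u) = R.rep y (R.rep x u) + R.rep (Coord.bracket x y) u
    simp only [Generators.rep_apply, ← hR.lie_lin, Ring.lie_def, Matrix.sub_mulVec,
      Matrix.mulVec_mulVec, ← WithLp.toLp_add, add_sub_cancel]
  inner_map x u v := by
    change inner ℂ (Matrix.toEuclideanLin (R.lin x) u) v =
      inner ℂ u (Matrix.toEuclideanLin (R.lin (Coord.conj x)) v)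
    rw [R.lin_conj (hR.conjTranspose_eq hH), Matrix.toEuclideanLin_conjTranspose_eq_adjoint,
      LinearMap.adjoint_inner_right]

/-- Only J_z and K_z enter, so V and V_t have no influence on the multiplicities. -/
theorem Generators.mem_weightSpace (a b : ℂ) (u : EuclideanSpace ℂ n) :
    u ∈ triangularData.weightSpace R.rep a b ↔
      R.J 2 *ᵥ u.ofLp = a • u.ofLp ∧ R.K 2 *ᵥ u.ofLp = b • u.ofLp := by
  rw [TriangularData.mem_weightSpace]
  simp [triangularData, Coord.jz, Coord.kz, Generators.rep_apply, Generators.lin_apply, Fin.sum_univ_three,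
    WithLp.ext_iff]

end Rep

/-! ### Comparison of multiplicities and passage to a unitary matrix -/

theorem finrank_weightSpace_le {n m : Type*} [Fintype n] [DecidableEq n] [Fintype m]
    [DecidableEq m] {R : Generators n} {R' : Generators m} {P : Matrix m n ℂ} {Q : Matrix n m ℂ}
    (hQP : Q * P = 1) (hJ : P * R.J 2 = R'.J 2 * P) (hK : P * R.K 2 = R'.K 2 * P) (a b : ℂ) :
    Module.finrank ℂ (triangularData.weightSpace R.rep a b) ≤
      Module.finrank ℂ (triangularData.weightSpace R'.rep a b) := by
  let F := Matrix.toEuclideanLin P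
  have hF : Function.Injective F := by
    intro u v h
    have h' := congrArg (fun w => Q *ᵥ w.ofLp) h
    exact WithLp.ofLp_injective 2 (by
      simpa [F, Matrix.toEuclideanLin, Matrix.ofLp_toLpLin, Matrix.toLin'_apply, Matrix.mulVec_mulVec, hQP] using h')
  rw [(Submodule.equivMapOfInjective F hF _).finrank_eq]
  refine Submodule.finrank_mono ?_
  rintro _ ⟨u, hu, rfl⟩
  rw [SetLike.mem_coe, Generators.mem_weightSpace] at hu
  rw [Generators.mem_weightSpace]
  simp only [F, Matrix.toEuclideanLin, Matrix.ofLp_toLpLin, Matrix.toLin'_apply, Matrix.mulVec_mulVec, ← hJ, ← hK]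
  simp only [← Matrix.mulVec_mulVec, hu, Matrix.mulVec_smul, and_self]

theorem mul_conj_eq {n m ι : Type*} [Fintype n] [Fintype m] [Fintype ι] [DecidableEq ι]
    {S : Matrix n ι ℂ} {T : Matrix ι n ℂ} {S' : Matrix m ι ℂ} {T' : Matrix ι m ℂ}
    (hTS : T * S = 1) (hTS' : T' * S' = 1) {X : Matrix ι ι ℂ} :
    S' * T * (S * X * T) = S' * X * T' * (S' * T) := by
  calc S' * T * (S * X * T) = S' * (T * S) * X * T := by simp only [Matrix.mul_assoc]
    _ = S' * X * (T' * S') * T := by rw [hTS, hTS', Matrix.mul_one, Matrix.mul_one]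
    _ = S' * X * T' * (S' * T) := by simp only [Matrix.mul_assoc]

theorem exists_unitary_matrix {n m : Type*} [Fintype n] [DecidableEq n] [Fintype m]
    [DecidableEq m] (F : EuclideanSpace ℂ n ≃ₗᵢ[ℂ] EuclideanSpace ℂ m) :
    ∃ U : Matrix m n ℂ, U * Uᴴ = 1 ∧ Uᴴ * U = 1 ∧ ∀ u, F u = WithLp.toLp 2 (U *ᵥ u.ofLp) := by
  let U : Matrix m n ℂ := Matrix.toEuclideanLin.symm F.toLinearEquiv.toLinearMap
  have hU : Matrix.toEuclideanLin U = F.toLinearEquiv.toLinearMap :=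
    Matrix.toEuclideanLin.apply_symm_apply _
  have hU' : ∀ u, F u = WithLp.toLp 2 (U *ᵥ u.ofLp) := fun u =>
    (LinearMap.congr_fun hU u).symm
  have hadj : ∀ w, F.symm w = WithLp.toLp 2 (Uᴴ *ᵥ w.ofLp) := by
    intro w
    refine ext_inner_left ℂ fun u => ?_
    have : WithLp.toLp 2 (Uᴴ *ᵥ w.ofLp) = Matrix.toEuclideanLin Uᴴ w := rfl
    rw [this, Matrix.toEuclideanLin_conjTranspose_eq_adjoint, LinearMap.adjoint_inner_right, hU]
    change _ = inner ℂ (F u) w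
    rw [← F.inner_map_map, F.apply_symm_apply]
  refine ⟨U, ?_, ?_, hU'⟩
  · refine Matrix.toEuclideanLin.injective (LinearMap.ext fun w => ?_)
    have h := F.apply_symm_apply w
    rw [hU', hadj] at h
    simpa [Matrix.toEuclideanLin, Matrix.toLpLin_apply, Matrix.mulVec_mulVec] using h
  · refine Matrix.toEuclideanLin.injective (LinearMap.ext fun w => ?_)
    have h := F.symm_apply_apply w
    rw [hadj, hU'] at h
    simpa [Matrix.toEuclideanLin, Matrix.toLpLin_apply, Matrix.mulVec_mulVec] using h

end DeSitter

end

theorem mainTheorem4 {N : ℕ} (s : DeSitter.Backbone N)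
    {n m : Type*} [Fintype n] [DecidableEq n] [Fintype m] [DecidableEq m]
    (R : DeSitter.Generators n) (R' : DeSitter.Generators m)
    (hR : R.IsDSRep) (hR' : R'.IsDSRep)
    (hH : R.IsHOrAH) (hH' : R'.IsHOrAH)
    (hs : R.HasBackbone s) (hs' : R'.HasBackbone s) :
    R.UnitarilyEquivalent R' := by
  obtain ⟨S, T, hST, hTS, hJ, hK⟩ := hs
  obtain ⟨S', T', hST', hTS', hJ', hK'⟩ := hs'
  have hdim : ∀ a b,
      Module.finrank ℂ (DeSitter.triangularData.weightSpace R.rep a b) =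
        Module.finrank ℂ (DeSitter.triangularData.weightSpace R'.rep a b) := by
    intro a b
    -- Passing through the backbone, S'T intertwines the Lorentz parts. It need not be unitary or
    -- respect V; it serves only to compare dimensions.
    refine le_antisymm
      (DeSitter.finrank_weightSpace_le (P := S' * T) (Q := S * T') ?_ ?_ ?_ a b)
      (DeSitter.finrank_weightSpace_le (P := S * T') (Q := S' * T) ?_ ?_ ?_ a b)
    · rw [Matrix.mul_assoc, ← Matrix.mul_assoc T', hTS', Matrix.one_mul, hST]
    · rw [hJ, hJ', DeSitter.mul_conj_eq hTS hTS']
    · rw [hK, hK', DeSitter.mul_conj_eq hTS hTS']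
    · rw [Matrix.mul_assoc, ← Matrix.mul_assoc T, hTS, Matrix.one_mul, hST']
    · rw [hJ, hJ', DeSitter.mul_conj_eq hTS' hTS]
    · rw [hK, hK', DeSitter.mul_conj_eq hTS' hTS]
  obtain ⟨F, hF⟩ := DeSitter.TriangularData.exists_isometryEquiv
    (hR.isUnitaryRep hH) (hR'.isUnitaryRep hH') hdim
  obtain ⟨U, hU₁, hU₂, hU⟩ := DeSitter.exists_unitary_matrix F
  have key : ∀ x, U * R.lin x * Uᴴ = R'.lin x := by
    intro x
    have h : U * R.lin x = R'.lin x * U := by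
      refine Matrix.toEuclideanLin.injective (LinearMap.ext fun u => ?_)
      have h := hF x u
      rw [DeSitter.Generators.rep_apply, DeSitter.Generators.rep_apply, hU, hU] at h
      simpa [Matrix.toEuclideanLin, Matrix.toLpLin_apply, Matrix.mulVec_mulVec] using h
    rw [h, Matrix.mul_assoc, hU₁, Matrix.mul_one]
  refine ⟨U, hU₁, hU₂, fun i => ?_, fun i => ?_, fun i => ?_, ?_⟩
  · simpa [DeSitter.Generators.lin_apply, Pi.single_apply] using key (Pi.single i 1, 0, 0, 0)
  · simpa [DeSitter.Generators.lin_apply, Pi.single_apply] using key (0, Pi.single i 1, 0, 0)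
  · simpa [DeSitter.Generators.lin_apply, Pi.single_apply] using key (0, 0, Pi.single i 1, 0)
  · simpa [DeSitter.Generators.lin_apply] using key (0, 0, 0, 1)
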